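/- Let $\mathcal{C}=\mathbb{Q}[\hbar]$ and let $\mathfrak{h}^1$ be the non-commutative polynomial algebra over $\mathcal{C}$ freely generated by letters $z_k$ $(k\ge 1)$. Let $\mathfrak{h}^1_{>0}$ be the $\mathcal{C}$-submodule spanned by the non-empty words, and $\mathfrak{h}^0$ the $\mathcal{C}$-submodule spanned by $1$ and the words $z_{k_1}\cdots z_{k_r}$ with $r\ge 1$, $k_1\ge 2$. Let $\mathcal{R}=\mathbb{Q}[[q]]$ with the $q$-adic topology, where $\hbar$ acts on $\mathcal{R}$ as multiplication by $1-q$, and put $[m]=\frac{1-q^m}{1-q}$. For a word define $$A_{z_{k_1}\cdots z_{k_r}}(n)=\sum_{n\ge m_1>\cdots>m_r>0}\frac{q^{(k_1-1)m_1+\cdots+(k_r-1)m_r}}{[m_1]^{k_1}\cdots[m_r]^{k_r}}\in\mathcal{R},\qquad A_1(n)=1,$$ extend $\mathcal{C}$-linearly to $w\mapsto A_w(n)$ on $\mathfrak{h}^1$, and for $w\in\mathfrak{h}^0$ let $\zeta_q(w)=\lim_{n\to\infty}A_w(n)\in\mathcal{R}$. Define $\mathcal{C}$-linear maps and a $\mathcal{C}$-bilinear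 product on $\mathfrak{h}^1$ as follows $(i,j\ge 1$; $w,w_1,w_2\in\mathfrak{h}^1)$. - $z_i\circ 1=0$ and $z_i\circ(z_jw)=z_{i+j}w$. - $d(1)=1$ and $d(z_iw)=z_i\,d(w)+z_i\circ d(w)$. - $1\,\overline{*}\,w=w\,\overline{*}\,1=w$ and $(z_iw_1)\,\overline{*}\,(z_jw_2)=z_i(w_1\,\overline{*}\,z_jw_2)+z_j(z_iw_1\,\overline{*}\,w_2)-z_{i+j}(w_1\,\overline{*}\,w_2)$. - For a word $u=z_{k_1}\cdots z_{k_r}$ let $p_1<\cdots<p_l$ be the elements of $\{1,\dots,k_1+\cdots+k_r\}\setminus\{k_1+\cdots+k_j \mid 1\le j<r\}$; then $\phi(u)=z_{p_1}z_{p_2-p_1}\cdots z_{p_l-p_{l-1}}$, and $\phi(1)=1$. Then for all $w_1,w_2\in\mathfrak{h}^1_{>0}$ the element $z_1\circ d(\phi(w_1\,\overline{*}\,w_2))$ lies in $\mathfrak{h}^0$, the limit defining its $\zeta_q$ exists, and $$\zeta_q\bigl(z_1\circ d(\phi(w_1\,\overline{*}\,w_2))\bigr)=0 .$$ -/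

import Mathlib

open Filter Topology

noncomputable section

namespace QMZV

/-- The coefficient ring `𝒞 = ℚ[ℏ]`. -/
abbrev Coeff : Type := Polynomial ℚ

/-- The non-commutative polynomial algebra `𝔥¹` over `ℚ[ℏ]`, freely generated by letters
`z_k` for `k ≥ 1`. -/
abbrev H1 : Type := FreeAlgebra Coeff ℕ+

/-- The letter `z_k`. -/
def z (k : ℕ+) : H1 := FreeAlgebra.ι Coeff k

/-- The word `z_{k₁} ⋯ z_{k_r}`; the empty word is `1`. -/
def word (u : List ℕ+) : H1 := (u.map z).prod

/-- The basis of `𝔥¹` formed by the words. -/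
def wordBasis : Module.Basis (List ℕ+) Coeff H1 :=
  FreeAlgebra.basisFreeMonoid Coeff ℕ+

theorem wordBasis_apply (u : List ℕ+) : wordBasis u = word u := by
  have h : wordBasis u =
      FreeAlgebra.equivMonoidAlgebraFreeMonoid.symm
        (MonoidAlgebra.of Coeff (FreeMonoid ℕ+) (FreeMonoid.ofList u)) := rfl
  rw [h]
  simp only [FreeAlgebra.equivMonoidAlgebraFreeMonoid, AlgEquiv.ofAlgHom_symm,
    AlgEquiv.ofAlgHom_apply, MonoidAlgebra.lift_of]
  simp [FreeMonoid.lift_apply, word]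
  rfl

/-- The `𝒞`-linear extension to `𝔥¹` of a map given on words. -/
def extendWords (f : List ℕ+ → H1) : H1 →ₗ[Coeff] H1 := wordBasis.constr Coeff f

/-- The submodule `𝔥¹_{>0}` spanned by the non-empty words. -/
def H1pos : Submodule Coeff H1 := Submodule.span Coeff {x | ∃ u : List ℕ+, u ≠ [] ∧ x = word u}

/-- The submodule `𝔥⁰` spanned by `1` and the words `z_{k₁} ⋯ z_{k_r}` with `r ≥ 1`, `k₁ ≥ 2`. -/
def H0 : Submodule Coeff H1 :=
  Submodule.span Coeff ({1} ∪ {x | ∃ (k : ℕ+) (u : List ℕ+), 2 ≤ k ∧ x = word (k :: u)})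

/-- The action `z_i ∘ -` on words: `z_i ∘ 1 = 0` and `z_i ∘ (z_j w) = z_{i+j} w`. -/
def circWord (i : ℕ+) : List ℕ+ → H1
  | [] => 0
  | j :: u => z (i + j) * word u

/-- The `𝒞`-linear action `z_i ∘ -` on `𝔥¹`. -/
def circ (i : ℕ+) : H1 →ₗ[Coeff] H1 := extendWords (circWord i)

/-- The map `d` on words: `d(1) = 1` and `d(z_i w) = z_i d(w) + z_i ∘ d(w)`. -/
def dWord : List ℕ+ → H1
  | [] => 1
  | i :: u => z i * dWord u + circ i (dWord u)

/-- The `𝒞`-linear map `d : 𝔥¹ → 𝔥¹`. -/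
def d : H1 →ₗ[Coeff] H1 := extendWords dWord

/-- The set `I_u = {k₁ + ⋯ + k_j | 1 ≤ j < r}` of a word `u = z_{k₁} ⋯ z_{k_r}`. -/
def partialSums (u : List ℕ+) : Finset ℕ :=
  (Finset.Ico 1 u.length).image fun j => ((u.take j).map PNat.val).sum

/-- The elements `p₁ < ⋯ < p_l` of `{1, …, k₁ + ⋯ + k_r} \ I_u`, in increasing order. -/
def complementList (u : List ℕ+) : List ℕ :=
  (List.range' 1 (u.map PNat.val).sum).filter fun p => p ∉ partialSums u

/-- The differences `p₁ - a, p₂ - p₁, …, p_l - p_{l-1}` of a list with `a < p₁ < ⋯ < p_l`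
(all of them are positive, so `Nat.toPNat'` keeps their values). -/
def differences : ℕ → List ℕ → List ℕ+
  | _, [] => []
  | a, p :: l => (p - a).toPNat' :: differences p l

/-- The map `φ` on words, as a map from index lists to index lists. -/
def phiWord (u : List ℕ+) : List ℕ+ := differences 0 (complementList u)

/-- The `𝒞`-linear map `φ : 𝔥¹ → 𝔥¹`. -/
def phi : H1 →ₗ[Coeff] H1 := extendWords fun u => word (phiWord u)

/-- The product `*̄` on words. -/
def barStarWord : List ℕ+ → List ℕ+ → H1
  | [], v => word v
  | i :: u, [] => word (i :: u)
  | i :: u, j :: v =>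
      z i * barStarWord u (j :: v) + z j * barStarWord (i :: u) v
        - z (i + j) * barStarWord u v
  termination_by u v => u.length + v.length

/-- The `𝒞`-bilinear product `*̄` on `𝔥¹`. -/
def barStar : H1 →ₗ[Coeff] H1 →ₗ[Coeff] H1 :=
  wordBasis.constr Coeff fun u => extendWords (barStarWord u)

/-- The ring `ℛ = ℚ⟦q⟧`. -/
abbrev R : Type := PowerSeries ℚ

/-- The formal variable `q` of `ℛ`. -/
def q : R := PowerSeries.X

/-- The `q`-adic topology on `ℛ`: the sets `f + (qⁿ)` form a neighbourhood base at `f`. -/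
instance qAdicTopology : TopologicalSpace R := (Ideal.span {q}).adicTopology

/-- The `q`-integer `[m] = (1 - q^m) / (1 - q)`. -/
def qInt (m : ℕ) : R := (1 - q ^ m) * (1 - q)⁻¹

/-- The structure map `ℚ[ℏ] → ℚ⟦q⟧`, `ℏ ↦ 1 - q`, through which `𝒞` acts on `ℛ`. -/
def hbarEval : Coeff →ₐ[ℚ] R := Polynomial.aeval (1 - q)

/-- For a word `u = z_{k₁} ⋯ z_{k_r}`, the finite multiple harmonic `q`-series
`A_u(n) = ∑_{n ≥ m₁ > ⋯ > m_r > 0} ∏ᵢ q^{(kᵢ - 1) mᵢ} / [mᵢ]^{kᵢ}`, written as an iterated sum over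
`m₁ ≤ n`, then `m₂ ≤ m₁ - 1`, and so on; `A_1(n) = 1`. -/
def AWord : List ℕ+ → ℕ → R
  | [], _ => 1
  | k :: u, n =>
      ∑ m ∈ Finset.Icc 1 n,
        q ^ (((k : ℕ) - 1) * m) * ((qInt m)⁻¹) ^ (k : ℕ) * AWord u (m - 1)

/-- The `𝒞`-linear extension `w ↦ A_w(n)` to `𝔥¹`. -/
def A (w : H1) (n : ℕ) : R :=
  (wordBasis.repr w).sum fun u c => hbarEval c * AWord u n

/-- The `q`-analogue of multiple zeta values: `ζ_q(w) = lim_{n → ∞} A_w(n)` for `w ∈ 𝔥⁰`. -/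
def zetaQ (w : H0) : R := limUnder atTop (A (w : H1))

end QMZV

end

noncomputable section

namespace QMZV

/-! ### Convergent series in `ℚ⟦q⟧` -/

/-! The proof is a `q`-analogue of Kawashima's argument. To a non-empty word `u` it attaches the
Newton series `G_u(x) = ∑ (-1)^k q^{k+1} s(k) P_{k+1}(x)`, where `x` stands for `q^N` and `s(k)` is
the part of the star sum of the dual word `φ(u)` with largest index `k + 1`.

Duality turns the recursions of `s` into the difference equation `G_{z_k u}(qx) - G_{z_k u}(x) =
D(x)^k G_u(qx)` with `D(x) = (1-q)qx/(1-qx)` (`kawashimaWord_q_mul_sub`). With `G_{z_k u}(1) = 0`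
and the congruence `x - y ∣ G(x) - G(y)`, it determines `G`; the discrete Leibniz rule then gives
`G_{u *̄ v} = G_u G_v` (`kawashima_barStar`).

For `w₁, w₂ ∈ 𝔥¹_{>0}` both factors vanish at `x = 1`, so the product vanishes to second order and
its slope there is zero (`slope_barStar`). Multiplied by `-(1-q)`, the slope of `G_w` at `1` is the
limit of `A` at `z₁ ∘ d(φ(w))` (`q_pow_dvd_A_circ_d_phi_add`). -/

theorem eq_zero_of_forall_q_pow_dvd {a : R} (h : ∀ n : ℕ, q ^ n ∣ a) : a = 0 := by
  ext m
  exact PowerSeries.X_pow_dvd_iff.1 (h (m + 1)) m m.lt_succ_self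

theorem mul_inv_of_q_dvd {a : R} (h : q ∣ a) : (1 - a) * (1 - a)⁻¹ = 1 := by
  refine PowerSeries.mul_inv_cancel _ ?_
  rw [map_sub, PowerSeries.X_dvd_iff.1 h]
  simp

theorem one_sub_q_pow_mul_inv (k : ℕ) : (1 - q ^ (k + 1)) * (1 - q ^ (k + 1))⁻¹ = 1 :=
  mul_inv_of_q_dvd (dvd_pow_self q k.succ_ne_zero)

theorem one_sub_q_mul_inv : (1 - q) * (1 - q)⁻¹ = 1 := mul_inv_of_q_dvd dvd_rfl

theorem one_sub_mul_inv (x : R) : (1 - q * x) * (1 - q * x)⁻¹ = 1 :=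
  mul_inv_of_q_dvd (dvd_mul_right q x)

theorem one_sub_q_mul_qInt (m : ℕ) : (1 - q) * qInt m = 1 - q ^ m := by
  rw [qInt, mul_left_comm, one_sub_q_mul_inv, mul_one]

theorem qInt_mul_inv (k : ℕ) : qInt (k + 1) * (qInt (k + 1))⁻¹ = 1 := by
  refine PowerSeries.mul_inv_cancel _ ?_
  simp [qInt, q]

theorem one_sub_q_pow_mul_qInt_inv (k : ℕ) :
    (1 - q ^ (k + 1)) * (qInt (k + 1))⁻¹ = 1 - q := by
  rw [← one_sub_q_mul_qInt, mul_assoc, qInt_mul_inv, mul_one]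

/-- The sum `∑ₖ q^k e_k`, defined coefficientwise. -/
def qSum (e : ℕ → R) : R :=
  PowerSeries.mk fun n => PowerSeries.coeff n (∑ k ∈ Finset.range (n + 1), q ^ k * e k)

theorem q_pow_dvd_qSum_sub (e : ℕ → R) (n : ℕ) :
    q ^ n ∣ qSum e - ∑ k ∈ Finset.range n, q ^ k * e k := by
  refine PowerSeries.X_pow_dvd_iff.2 fun m hm => ?_
  have h : q ^ (m + 1) ∣ ∑ k ∈ Finset.Ico (m + 1) n, q ^ k * e k :=
    Finset.dvd_sum fun k hk => (pow_dvd_pow q (Finset.mem_Ico.1 hk).1).mul_right _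
  rw [← Finset.sum_range_add_sum_Ico _ (Nat.succ_le_of_lt hm), map_sub, map_add, qSum,
    PowerSeries.coeff_mk, PowerSeries.X_pow_dvd_iff.1 h m m.lt_succ_self]
  simp

/-- Reduces identities between infinite sums to congruences modulo `q^n` for finite ones, so no
topology is needed before the end. -/
theorem eq_qSum {e : ℕ → R} {a : R}
    (h : ∀ n, q ^ n ∣ a - ∑ k ∈ Finset.range n, q ^ k * e k) : a = qSum e := by
  refine sub_eq_zero.1 (eq_zero_of_forall_q_pow_dvd fun n => ?_)
  have := dvd_sub (h n) (q_pow_dvd_qSum_sub e n)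
  rwa [sub_sub_sub_cancel_right] at this

theorem qSum_add (e f : ℕ → R) : qSum (fun k => e k + f k) = qSum e + qSum f := by
  refine (eq_qSum fun n => ?_).symm
  have := dvd_add (q_pow_dvd_qSum_sub e n) (q_pow_dvd_qSum_sub f n)
  simp only [mul_add, Finset.sum_add_distrib]
  convert this using 1
  ring

theorem qSum_mul (c : R) (e : ℕ → R) : qSum (fun k => c * e k) = c * qSum e := by
  refine (eq_qSum fun n => ?_).symm
  have := (q_pow_dvd_qSum_sub e n).mul_left c
  simp only [mul_left_comm _ c, ← Finset.mul_sum]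
  rwa [← mul_sub]

theorem qSum_sub (e f : ℕ → R) : qSum (fun k => e k - f k) = qSum e - qSum f := by
  have h := qSum_add (fun k => e k - f k) f
  simp only [sub_add_cancel] at h
  exact eq_sub_of_add_eq h.symm

theorem qSum_succ (e : ℕ → R) : qSum e = e 0 + q * qSum (fun k => e (k + 1)) := by
  refine (eq_qSum fun n => ?_).symm
  cases n with
  | zero => simp
  | succ n =>
    have := mul_dvd_mul_left q (q_pow_dvd_qSum_sub (fun k => e (k + 1)) n)
    rw [Finset.sum_range_succ']
    simp only [pow_succ', mul_assoc, ← Finset.mul_sum, pow_zero, one_mul]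
    convert this using 1
    ring

theorem qSum_telescope (g : ℕ → R) :
    qSum (fun k => (-1) ^ k * (g k + q * g (k + 1))) = g 0 := by
  have h := qSum_succ fun k => (-1) ^ k * g k
  rw [← qSum_mul, pow_zero, one_mul, ← sub_eq_iff_eq_add, ← qSum_sub] at h
  rw [← h]
  congr 1
  funext k
  ring

/-! ### The Newton basis -/

/-- The polynomial `∏_{i < k} (q^i - x) / (1 - q^{i+1})`. -/
def newtonPoly (x : R) : ℕ → R
  | 0 => 1
  | k + 1 => (q ^ k - x) * (1 - q ^ (k + 1))⁻¹ * newtonPoly x k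

theorem newtonPoly_succ (x : R) (k : ℕ) :
    (1 - q ^ (k + 1)) * newtonPoly x (k + 1) = (q ^ k - x) * newtonPoly x k := by
  rw [newtonPoly]
  linear_combination (q ^ k - x) * newtonPoly x k * one_sub_q_pow_mul_inv k

/-- Trades the factor `1 - qx` for `1 - q^{k+1}`, which cancels denominators of the coefficients and
leaves the pattern of `qSum_telescope`. -/
theorem one_sub_mul_newtonPoly (x : R) (k : ℕ) :
    (1 - q * x) * newtonPoly x k =
      (1 - q ^ (k + 1)) * (newtonPoly x k + q * newtonPoly x (k + 1)) := by
  linear_combination -q * newtonPoly_succ x k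

theorem one_sub_q_pow_ne_zero (k : ℕ) : (1 - q ^ (k + 1) : R) ≠ 0 :=
  left_ne_zero_of_mul_eq_one (one_sub_q_pow_mul_inv k)

/-- For `i ≥ 1`, `q^i - qx = q(q^{i-1} - x)`: only the factor `1 - qx` is new. -/
theorem newtonPoly_q_mul (x : R) (k : ℕ) :
    (1 - q ^ (k + 1)) * newtonPoly (q * x) (k + 1) = q ^ k * (1 - q * x) * newtonPoly x k := by
  induction k with
  | zero =>
    simp only [newtonPoly, pow_zero, zero_add, pow_one]
    linear_combination (1 - q * x) * one_sub_q_mul_inv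
  | succ k ih =>
    refine mul_left_cancel₀ (one_sub_q_pow_ne_zero k) ?_
    rw [newtonPoly_succ]
    linear_combination (q ^ (k + 1) - q * x) * ih
      - q ^ (k + 1) * (1 - q * x) * newtonPoly_succ x k

/-- At `x = q^N` this is the `q`-Pascal rule. -/
theorem newtonPoly_q_mul_sub (x : R) (k : ℕ) :
    newtonPoly (q * x) (k + 1) - newtonPoly x (k + 1) = x * newtonPoly x k := by
  refine mul_left_cancel₀ (one_sub_q_pow_ne_zero k) ?_
  linear_combination newtonPoly_q_mul x k - newtonPoly_succ x k

theorem newtonPoly_one (k : ℕ) : newtonPoly 1 (k + 1) = 0 := by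
  induction k with
  | zero => simp [newtonPoly]
  | succ k ih => rw [newtonPoly, ih, mul_zero]

theorem sub_dvd_newtonPoly_sub (x y : R) (k : ℕ) :
    x - y ∣ newtonPoly x k - newtonPoly y k := by
  induction k with
  | zero => simp [newtonPoly]
  | succ k ih =>
    obtain ⟨r, hr⟩ := ih
    refine ⟨(1 - q ^ (k + 1))⁻¹ * ((q ^ k - x) * r - newtonPoly y k), ?_⟩
    simp only [newtonPoly]
    linear_combination (q ^ k - x) * (1 - q ^ (k + 1))⁻¹ * hr

/-- The factor `i = 0` vanishes at `1` and gives `-y`; the other factors, evaluated at `1`, cancel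
against the denominators up to sign, leaving only `1 - q^{k+1}`. -/
theorem newtonPoly_one_add (y : R) (k : ℕ) : ∃ r, newtonPoly (1 + y) (k + 1) =
    -y * ((-1) ^ k * (1 - q ^ (k + 1))⁻¹) + y ^ 2 * r := by
  induction k with
  | zero => exact ⟨0, by simp [newtonPoly]⟩
  | succ k ih =>
    obtain ⟨r, hr⟩ := ih
    refine ⟨(1 - q ^ (k + 2))⁻¹ *
      ((-1) ^ k * (1 - q ^ (k + 1))⁻¹ - (1 - q ^ (k + 1)) * r - y * r), ?_⟩
    rw [newtonPoly, hr]
    linear_combination (y * (-1) ^ k * (1 - q ^ (k + 2))⁻¹) * one_sub_q_pow_mul_inv k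

/-! ### Newton series -/

/-- The Newton series `∑ₖ (-1)^k q^{k+1} a_k P_{k+1}(x)`. -/
def newtonSeries (a : ℕ → R) (x : R) : R :=
  q * qSum fun k => (-1) ^ k * (a k * newtonPoly x (k + 1))

/-- The Newton series `∑ₖ (-1)^k q^{k+1} a_k P_k(x)`. -/
def newtonDiff (a : ℕ → R) (x : R) : R :=
  q * qSum fun k => (-1) ^ k * (a k * newtonPoly x k)

theorem newtonSeries_q_mul_sub (a : ℕ → R) (x : R) :
    newtonSeries a (q * x) - newtonSeries a x = x * newtonDiff a x := by
  have h : qSum (fun k => (-1) ^ k * (a k * newtonPoly (q * x) (k + 1))) -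
      qSum (fun k => (-1) ^ k * (a k * newtonPoly x (k + 1))) =
      x * qSum fun k => (-1) ^ k * (a k * newtonPoly x k) := by
    rw [← qSum_sub, ← qSum_mul]
    congr 1
    funext k
    linear_combination (-1) ^ k * a k * newtonPoly_q_mul_sub x k
  simp only [newtonSeries, newtonDiff]
  linear_combination q * h

theorem newtonSeries_one (a : ℕ → R) : newtonSeries a 1 = 0 := by
  have h := qSum_mul 0 fun _ => 0
  simp only [zero_mul] at h
  simp [newtonSeries, newtonPoly_one, h]

theorem sub_dvd_newtonSeries_sub (a : ℕ → R) (x y : R) :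
    x - y ∣ newtonSeries a x - newtonSeries a y := by
  choose r hr using sub_dvd_newtonPoly_sub x y
  have h : qSum (fun k => (-1) ^ k * (a k * newtonPoly x (k + 1))) -
      qSum (fun k => (-1) ^ k * (a k * newtonPoly y (k + 1))) =
      (x - y) * qSum fun k => (-1) ^ k * (a k * r (k + 1)) := by
    rw [← qSum_sub, ← qSum_mul]
    congr 1
    funext k
    linear_combination (-1) ^ k * a k * hr (k + 1)
  refine ⟨q * qSum fun k => (-1) ^ k * (a k * r (k + 1)), ?_⟩
  simp only [newtonSeries]
  linear_combination q * h

theorem newtonSeries_one_add (a : ℕ → R) (y : R) :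
    y ^ 2 ∣ newtonSeries a (1 + y) - y * (-(q * qSum fun k => a k * (1 - q ^ (k + 1))⁻¹)) := by
  choose r hr using newtonPoly_one_add y
  have h : qSum (fun k => (-1) ^ k * (a k * newtonPoly (1 + y) (k + 1))) +
      y * qSum (fun k => a k * (1 - q ^ (k + 1))⁻¹) =
      y ^ 2 * qSum fun k => (-1) ^ k * (a k * r k) := by
    rw [← qSum_mul, ← qSum_add, ← qSum_mul]
    congr 1
    funext k
    have h : ((-1 : R) ^ k) * (-1) ^ k = 1 := by rw [← mul_pow]; simp
    linear_combination (-1) ^ k * a k * hr k - y * a k * (1 - q ^ (k + 1))⁻¹ * h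
  refine ⟨q * qSum fun k => (-1) ^ k * (a k * r k), ?_⟩
  simp only [newtonSeries]
  linear_combination q * h

/-- This lemma and the next two are modelled on the recursions of `starTop`: the word `z_1`, a
prepended `z_1`, and a raised first letter. -/
theorem newtonDiff_of_mul_eq_one {b : ℕ → R} (x : R)
    (hb : ∀ k, (1 - q ^ (k + 1)) * b k = 1 - q) :
    (1 - q * x) * newtonDiff b x = (1 - q) * q := by
  have h := qSum_telescope (newtonPoly x)
  have h' : (1 - q * x) * qSum (fun k => (-1) ^ k * (b k * newtonPoly x k)) =
      (1 - q) * qSum fun k => (-1) ^ k * (newtonPoly x k + q * newtonPoly x (k + 1)) := by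
    rw [← qSum_mul, ← qSum_mul]
    congr 1
    funext k
    linear_combination (-1) ^ k * b k * one_sub_mul_newtonPoly x k +
      (-1) ^ k * (newtonPoly x k + q * newtonPoly x (k + 1)) * hb k
  rw [h, newtonPoly, mul_one] at h'
  rw [newtonDiff]
  linear_combination q * h'

theorem newtonDiff_of_sum {a b : ℕ → R} (x : R)
    (hb : ∀ k, (1 - q ^ (k + 1)) * b k =
      (1 - q) * (∑ l ∈ Finset.range k, a l + q ^ (k + 1) * a k)) :
    (1 - q * x) * newtonDiff b x = (1 - q) * q * x * newtonDiff a x := by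
  -- Summation by parts: the telescoping part starts from the empty sum, hence is zero; what is left
  -- over is the series of `a`.
  have h := qSum_telescope fun k => (∑ l ∈ Finset.range k, a l) * newtonPoly x k
  have h' : (1 - q * x) * qSum (fun k => (-1) ^ k * (b k * newtonPoly x k)) -
      (1 - q) * q * x * qSum (fun k => (-1) ^ k * (a k * newtonPoly x k)) =
      (1 - q) * qSum fun k => (-1) ^ k * ((∑ l ∈ Finset.range k, a l) * newtonPoly x k +
        q * ((∑ l ∈ Finset.range (k + 1), a l) * newtonPoly x (k + 1))) := by
    rw [← qSum_mul, ← qSum_mul, ← qSum_mul, ← qSum_sub]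
    congr 1
    funext k
    rw [Finset.sum_range_succ]
    linear_combination (-1) ^ k * b k * one_sub_mul_newtonPoly x k +
      (-1) ^ k * (newtonPoly x k + q * newtonPoly x (k + 1)) * hb k -
      (-1) ^ k * (1 - q) * q * a k * newtonPoly_succ x k
  rw [h, Finset.sum_range_zero, zero_mul, mul_zero] at h'
  simp only [newtonDiff]
  linear_combination q * h'

theorem newtonDiff_of_mul {a b : ℕ → R} (x : R)
    (hb : ∀ k, (1 - q ^ (k + 1)) * b k = (1 - q) * q ^ (k + 1) * a k) :
    (1 - q * x) * newtonDiff b x = (1 - q) * q * newtonSeries a (q * x) := by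
  have h : (1 - q * x) * qSum (fun k => (-1) ^ k * (b k * newtonPoly x k)) =
      (1 - q) * q * qSum (fun k => (-1) ^ k * (a k * newtonPoly (q * x) (k + 1))) := by
    rw [← qSum_mul, ← qSum_mul]
    congr 1
    funext k
    refine mul_left_cancel₀ (one_sub_q_pow_ne_zero k) ?_
    linear_combination (-1) ^ k * (1 - q * x) * newtonPoly x k * hb k -
      (-1) ^ k * (1 - q) * q * a k * newtonPoly_q_mul x k
  simp only [newtonDiff, newtonSeries]
  linear_combination q * h

/-! ### Combinatorics of `φ` -/

theorem mem_partialSums_cons {k : ℕ+} {u : List ℕ+} {p : ℕ} :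
    p ∈ partialSums (k :: u) ↔
      ∃ j < u.length, (k : ℕ) + ((u.take j).map PNat.val).sum = p := by
  simp only [partialSums, Finset.mem_image, Finset.mem_Ico, List.length_cons]
  constructor
  · rintro ⟨j, ⟨h1, h2⟩, rfl⟩
    obtain ⟨j, rfl⟩ := Nat.exists_eq_add_of_le' h1
    exact ⟨j, by omega, by simp⟩
  · rintro ⟨j, h, rfl⟩
    exact ⟨j + 1, ⟨by omega, by omega⟩, by simp⟩

theorem sum_map_val_cons (k : ℕ+) (u : List ℕ+) :
    ((k :: u).map PNat.val).sum = k + (u.map PNat.val).sum := by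
  simp

theorem one_mem_partialSums_one_cons {u : List ℕ+} (hu : u ≠ []) : 1 ∈ partialSums (1 :: u) :=
  mem_partialSums_cons.2 ⟨0, List.length_pos_iff.2 hu, by simp⟩

theorem add_two_mem_partialSums_one_cons {u : List ℕ+} {p : ℕ} :
    p + 1 + 1 ∈ partialSums (1 :: u) ↔ p + 1 ∈ partialSums u := by
  rw [mem_partialSums_cons]
  cases u with
  | nil => simp [partialSums]
  | cons k u =>
    rw [mem_partialSums_cons]
    constructor
    · rintro ⟨j, hj, h⟩
      cases j with
      | zero => simp at h
      | succ j =>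
        refine ⟨j, by simpa using hj, ?_⟩
        simp only [List.take_succ_cons, List.map_cons, List.sum_cons, PNat.one_coe] at h
        omega
    · rintro ⟨j, hj, h⟩
      refine ⟨j + 1, by simpa using hj, ?_⟩
      simp only [List.take_succ_cons, List.map_cons, List.sum_cons, PNat.one_coe]
      omega

theorem one_notMem_partialSums_succ_cons (k : ℕ+) (u : List ℕ+) :
    1 ∉ partialSums ((k + 1) :: u) := by
  rw [mem_partialSums_cons]
  rintro ⟨j, -, h⟩
  have := k.pos
  rw [PNat.add_coe, PNat.one_coe] at h
  omega

theorem succ_mem_partialSums_succ_cons {k : ℕ+} {u : List ℕ+} {p : ℕ} :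
    p + 1 ∈ partialSums ((k + 1) :: u) ↔ p ∈ partialSums (k :: u) := by
  simp only [mem_partialSums_cons, PNat.add_coe, PNat.one_coe]
  refine exists_congr fun j => and_congr_right fun _ => ?_
  omega

theorem filter_range'_one_succ (s : Finset ℕ) (t : Finset ℕ) (n : ℕ)
    (h : ∀ p, p + 1 + 1 ∈ s ↔ p + 1 ∈ t) :
    (List.range' 1 (n + 1)).filter (fun p => p ∉ s) =
      [1].filter (fun p => p ∉ s) ++
        ((List.range' 1 n).filter (fun p => p ∉ t)).map (· + 1) := by
  rw [List.range'_succ, ← List.singleton_append, List.filter_append]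
  congr 1
  rw [List.range'_eq_map_range, List.range'_eq_map_range, List.filter_map, List.filter_map,
    List.map_map]
  have : ((fun p => decide (p ∉ s)) ∘ fun x => 1 + 1 + x) =
      ((fun p => decide (p ∉ t)) ∘ fun x => 1 + x) := by
    funext p
    have := h p
    simp only [Function.comp, show 1 + 1 + p = p + 1 + 1 by ring, Nat.add_comm 1 p, this]
  rw [this]
  congr 1
  funext p
  simp
  ring

theorem complementList_one_cons {u : List ℕ+} (hu : u ≠ []) :
    complementList (1 :: u) = (complementList u).map (· + 1) := by
  rw [complementList, sum_map_val_cons, PNat.one_coe, Nat.add_comm, filter_range'_one_succ _ _ _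
    fun _ => add_two_mem_partialSums_one_cons, complementList]
  simp [one_mem_partialSums_one_cons hu]

theorem complementList_succ_cons (k : ℕ+) (u : List ℕ+) :
    complementList ((k + 1) :: u) = 1 :: (complementList (k :: u)).map (· + 1) := by
  rw [complementList, sum_map_val_cons, PNat.add_coe, PNat.one_coe, Nat.add_right_comm,
    filter_range'_one_succ _ _ _ fun _ => succ_mem_partialSums_succ_cons, complementList,
    sum_map_val_cons]
  simp [one_notMem_partialSums_succ_cons]

theorem differences_succ_map_succ (l : List ℕ) (a : ℕ) :
    differences (a + 1) (l.map (· + 1)) = differences a l := by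
  induction l generalizing a with
  | nil => rfl
  | cons p l ih => rw [List.map_cons, differences, ih, differences, Nat.add_sub_add_right]

/-- Taking complements exchanges whether `1` is a break point, so raising the first letter is dual
to prepending `z_1`. -/
theorem phiWord_succ_cons (k : ℕ+) (u : List ℕ+) :
    phiWord ((k + 1) :: u) = 1 :: phiWord (k :: u) := by
  rw [phiWord, complementList_succ_cons, differences, differences_succ_map_succ]
  rfl

theorem phiWord_singleton_one : phiWord [1] = [1] := rfl

theorem phiWord_one_cons_of_phiWord {u v : List ℕ+} {k : ℕ+} (hu : u ≠ [])
    (h : phiWord u = k :: v) : phiWord (1 :: u) = (k + 1) :: v := by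
  rw [phiWord, complementList_one_cons hu]
  rw [phiWord] at h
  cases hl : complementList u with
  | nil => simp [hl, differences] at h
  | cons p l =>
    -- Positivity matters because `Nat.toPNat'` sends both `0` and `1` to `1`.
    have hp : 0 < p := by
      have : p ∈ complementList u := by simp [hl]
      simp only [complementList, List.mem_filter, List.mem_range'_1] at this
      omega
    rw [hl, differences, List.cons.injEq] at h
    rw [List.map_cons, differences, differences_succ_map_succ, h.2, ← h.1]
    congr 1
    apply PNat.eq
    rw [PNat.add_coe, Nat.toPNat'_coe, Nat.toPNat'_coe]
    simp [hp]

theorem exists_phiWord_one_cons {u : List ℕ+} (hu : u ≠ []) :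
    ∃ (k : ℕ+) (v : List ℕ+), phiWord u = k :: v ∧ phiWord (1 :: u) = (k + 1) :: v := by
  have h : ∃ (k : ℕ+) (v : List ℕ+), phiWord u = k :: v := by
    induction u with
    | nil => exact absurd rfl hu
    | cons k u ih =>
      cases k using PNat.recOn with
      | one =>
        rcases eq_or_ne u [] with rfl | hu'
        · exact ⟨1, [], rfl⟩
        · obtain ⟨k, v, h⟩ := ih hu'
          exact ⟨k + 1, v, phiWord_one_cons_of_phiWord hu' h⟩
      | succ k => exact ⟨1, _, phiWord_succ_cons k u⟩
  obtain ⟨k, v, h⟩ := h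
  exact ⟨k, v, h, phiWord_one_cons_of_phiWord hu h⟩

/-! ### Words and linear extension -/

theorem extendWords_word (f : List ℕ+ → H1) (u : List ℕ+) : extendWords f (word u) = f u := by
  rw [extendWords, ← wordBasis_apply, Module.Basis.constr_basis]

theorem word_cons (k : ℕ+) (u : List ℕ+) : word (k :: u) = z k * word u := by
  simp [word]

theorem circ_word_cons (i j : ℕ+) (u : List ℕ+) :
    circ i (word (j :: u)) = word ((i + j) :: u) := by
  rw [circ, extendWords_word, circWord, word_cons]

theorem circ_word_nil (i : ℕ+) : circ i (word []) = 0 := by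
  rw [circ, extendWords_word, circWord]

theorem d_word (u : List ℕ+) : d (word u) = dWord u := by
  rw [d, extendWords_word]

theorem phi_word (u : List ℕ+) : phi (word u) = word (phiWord u) := by
  rw [phi, extendWords_word]

theorem barStar_word (u v : List ℕ+) : barStar (word u) (word v) = barStarWord u v := by
  rw [barStar, ← wordBasis_apply, Module.Basis.constr_basis, extendWords_word]

theorem induction_words {p : H1 → Prop} (word : ∀ u, p (word u)) (zero : p 0)
    (add : ∀ a b, p a → p b → p (a + b)) (smul : ∀ (c : Coeff) a, p a → p (c • a)) (w : H1) :
    p w := by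
  have h : w ∈ Submodule.span Coeff (Set.range wordBasis) := wordBasis.mem_span w
  induction h using Submodule.span_induction with
  | mem x hx =>
    obtain ⟨u, rfl⟩ := hx
    rw [wordBasis_apply]
    exact word u
  | zero => exact zero
  | add a b _ _ ha hb => exact add a b ha hb
  | smul c a _ ha => exact smul c a ha

/-- The extension of an `ℛ`-valued function on words to `𝔥¹`, where `ℏ` acts as `1 - q`. -/
def liftWords (f : List ℕ+ → R) : H1 →ₛₗ[hbarEval.toRingHom] R where
  toFun w := (wordBasis.repr w).sum fun u c => hbarEval c * f u
  map_add' v w := by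
    rw [map_add]
    exact Finsupp.sum_add_index' (by simp) (by simp [add_mul])
  map_smul' c w := by
    rw [map_smul, Finsupp.sum_smul_index (by simp), smul_eq_mul, Finsupp.mul_sum]
    simp [mul_assoc]

theorem liftWords_word (f : List ℕ+ → R) (u : List ℕ+) : liftWords f (word u) = f u := by
  have h : liftWords f (word u) =
    (wordBasis.repr (word u)).sum fun u c => hbarEval c * f u := rfl
  rw [h, ← wordBasis_apply, Module.Basis.repr_self, Finsupp.sum_single_index (by simp)]
  simp

theorem A_eq_liftWords (w : H1) (n : ℕ) : A w n = liftWords (fun u => AWord u n) w := rfl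

/-- The part `m₁ = m` of the sum defining `A_u`. -/
def topWord : List ℕ+ → ℕ → R
  | [], _ => 0
  | k :: u, m => q ^ (((k : ℕ) - 1) * m) * (qInt m)⁻¹ ^ (k : ℕ) * AWord u (m - 1)

/-- The `𝒞`-linear extension of `topWord` to `𝔥¹`. -/
def top (m : ℕ) : H1 →ₛₗ[hbarEval.toRingHom] R := liftWords fun u => topWord u m

theorem top_z_mul (k : ℕ+) (w : H1) (m : ℕ) :
    top m (z k * w) = q ^ (((k : ℕ) - 1) * m) * (qInt m)⁻¹ ^ (k : ℕ) * A w (m - 1) := by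
  simp only [A_eq_liftWords]
  induction w using induction_words with
  | word u => rw [← word_cons, top, liftWords_word, liftWords_word, topWord]
  | zero => rw [mul_zero, map_zero, map_zero, mul_zero]
  | add a b ha hb => rw [mul_add, map_add, map_add, ha, hb, mul_add]
  | smul c a ha =>
    rw [mul_smul_comm, LinearMap.map_smulₛₗ, LinearMap.map_smulₛₗ, ha, smul_eq_mul, smul_eq_mul,
      mul_left_comm]

theorem top_circ (i : ℕ+) (w : H1) (m : ℕ) :
    top m (circ i w) = (q ^ m * (qInt m)⁻¹) ^ (i : ℕ) * top m w := by
  induction w using induction_words with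
  | word u =>
    cases u with
    | nil => rw [circ_word_nil, map_zero, top, liftWords_word, topWord, mul_zero]
    | cons j u =>
      rw [circ_word_cons, top, liftWords_word, liftWords_word, topWord, topWord, PNat.add_coe,
        Nat.add_sub_assoc j.pos]
      ring
  | zero => rw [map_zero, map_zero, mul_zero]
  | add a b ha hb => rw [map_add, map_add, map_add, ha, hb, mul_add]
  | smul c a ha =>
    rw [map_smul, LinearMap.map_smulₛₗ, LinearMap.map_smulₛₗ, ha, smul_eq_mul, smul_eq_mul,
      mul_left_comm]

/-- `A w 0` accounts for the empty word, which has no largest index. -/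
theorem A_eq_sum_top (w : H1) (n : ℕ) :
    A w n = A w 0 + ∑ m ∈ Finset.range n, top (m + 1) w := by
  simp only [A_eq_liftWords]
  induction w using induction_words with
  | word u =>
    simp only [liftWords_word, top]
    cases u with
    | nil => simp [AWord, topWord]
    | cons k u =>
      simp only [AWord, topWord]
      induction n with
      | zero => simp
      | succ n ih => rw [Finset.sum_Icc_succ_top (by omega), Finset.sum_range_succ, ih, add_assoc]
  | zero => simp only [map_zero, Finset.sum_const_zero, add_zero]
  | add a b ha hb =>
    rw [map_add, map_add, ha, hb]
    simp only [map_add, Finset.sum_add_distrib]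
    ring
  | smul c a ha =>
    rw [LinearMap.map_smulₛₗ, LinearMap.map_smulₛₗ, ha]
    simp only [LinearMap.map_smulₛₗ, ← Finset.smul_sum, smul_add]

theorem A_z_mul_zero (k : ℕ+) (w : H1) : A (z k * w) 0 = 0 := by
  simp only [A_eq_liftWords]
  induction w using induction_words with
  | word u => rw [← word_cons, liftWords_word]; simp [AWord]
  | zero => rw [mul_zero, map_zero]
  | add a b ha hb => rw [mul_add, map_add, ha, hb, add_zero]
  | smul c a ha => rw [mul_smul_comm, LinearMap.map_smulₛₗ, ha, smul_zero]

theorem A_circ_zero (i : ℕ+) (w : H1) : A (circ i w) 0 = 0 := by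
  simp only [A_eq_liftWords]
  induction w using induction_words with
  | word u =>
    cases u with
    | nil => rw [circ_word_nil, map_zero]
    | cons j u => rw [circ_word_cons, liftWords_word]; simp [AWord]
  | zero => rw [map_zero, map_zero]
  | add a b ha hb => rw [map_add, map_add, ha, hb, add_zero]
  | smul c a ha => rw [map_smul, LinearMap.map_smulₛₗ, ha, smul_zero]

theorem circ_mem_H0 (i : ℕ+) (w : H1) : circ i w ∈ H0 := by
  induction w using induction_words with
  | word u =>
    cases u with
    | nil => rw [circ_word_nil]; exact H0.zero_mem
    | cons j u =>
      rw [circ_word_cons]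
      exact Submodule.subset_span (Or.inr ⟨i + j, u, add_le_add one_le one_le, rfl⟩)
  | zero => rw [map_zero]; exact H0.zero_mem
  | add a b ha hb => rw [map_add]; exact H0.add_mem ha hb
  | smul c a ha => rw [map_smul]; exact H0.smul_mem c ha

/-! ### Star sums with fixed largest index -/

/-- The part `m₁ = k + 1` of the sum `A_{d(u)}`. -/
def starTop (u : List ℕ+) (k : ℕ) : R := top (k + 1) (dWord u)

theorem starTop_singleton_one (k : ℕ) : starTop [1] k = (qInt (k + 1))⁻¹ := by
  have h : A (word []) k = 1 := by rw [A_eq_liftWords, liftWords_word, AWord]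
  have h' : circ 1 (1 : H1) = 0 := circ_word_nil 1
  rw [starTop, dWord, dWord, map_add, top_z_mul, h', map_zero, Nat.add_sub_cancel]
  change _ * A (word []) k + _ = _
  simp [h]

theorem starTop_succ_cons (i : ℕ+) (u : List ℕ+) (k : ℕ) :
    starTop ((i + 1) :: u) k = q ^ (k + 1) * (qInt (k + 1))⁻¹ * starTop (i :: u) k := by
  simp only [starTop, dWord, map_add, top_z_mul, top_circ]
  obtain ⟨j, hj⟩ := Nat.exists_eq_succ_of_ne_zero i.ne_zero
  simp only [PNat.add_coe, PNat.one_coe, hj, Nat.succ_eq_add_one, Nat.add_sub_cancel]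
  ring

/-- The two terms of `d` give `m₂ < m₁` and `m₂ = m₁`; together they make the inequality non-strict.
-/
theorem starTop_one_cons {u : List ℕ+} (hu : u ≠ []) (k : ℕ) :
    starTop (1 :: u) k = (qInt (k + 1))⁻¹ *
      (∑ l ∈ Finset.range k, starTop u l + q ^ (k + 1) * starTop u k) := by
  have h : A (dWord u) 0 = 0 := by
    cases u with
    | nil => exact absurd rfl hu
    | cons i u =>
      rw [dWord, A_eq_liftWords, map_add, ← A_eq_liftWords, ← A_eq_liftWords, A_z_mul_zero,
        A_circ_zero, add_zero]
  rw [starTop, dWord, map_add, top_z_mul, top_circ, A_eq_sum_top, h, PNat.one_coe, Nat.sub_self,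
    zero_mul, pow_zero, pow_one, pow_one, Nat.add_sub_cancel]
  simp only [starTop]
  ring

/-! ### The `q`-Kawashima function -/

/-- The `q`-Kawashima function of a word: the Newton series with coefficients given by the star
sums of the dual word. -/
def kawashimaWord (x : R) : List ℕ+ → R
  | [] => 1
  | k :: u => newtonSeries (starTop (phiWord (k :: u))) x

/-- The `𝒞`-linear extension of `kawashimaWord` to `𝔥¹`. -/
def kawashima (x : R) : H1 →ₛₗ[hbarEval.toRingHom] R := liftWords (kawashimaWord x)

theorem kawashima_word (x : R) (u : List ℕ+) : kawashima x (word u) = kawashimaWord x u :=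
  liftWords_word _ u

theorem kawashimaWord_of_ne_nil (x : R) {u : List ℕ+} (hu : u ≠ []) :
    kawashimaWord x u = newtonSeries (starTop (phiWord u)) x := by
  cases u with
  | nil => exact absurd rfl hu
  | cons k u => rw [kawashimaWord]

/-- The value of `q^N / [N]` at `q^N = q x`. -/
def diffFactor (x : R) : R := (1 - q) * q * x * (1 - q * x)⁻¹

theorem one_sub_mul_diffFactor (x : R) : (1 - q * x) * diffFactor x = (1 - q) * q * x := by
  rw [diffFactor, mul_left_comm, one_sub_mul_inv, mul_one]

theorem newtonDiff_starTop_one_cons {u : List ℕ+} (hu : u ≠ []) (x : R) :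
    newtonDiff (starTop (1 :: u)) x = diffFactor x * newtonDiff (starTop u) x := by
  have h := newtonDiff_of_sum (a := starTop u) (b := starTop (1 :: u)) x fun k => by
    rw [starTop_one_cons hu, ← mul_assoc, one_sub_q_pow_mul_qInt_inv]
  refine mul_left_cancel₀ (left_ne_zero_of_mul_eq_one (one_sub_mul_inv x)) ?_
  rw [h, ← mul_assoc, one_sub_mul_diffFactor]

theorem newtonDiff_starTop_succ_cons (i : ℕ+) (u : List ℕ+) (x : R) :
    x * newtonDiff (starTop ((i + 1) :: u)) x =
      diffFactor x * newtonSeries (starTop (i :: u)) (q * x) := by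
  have h := newtonDiff_of_mul (a := starTop (i :: u)) (b := starTop ((i + 1) :: u)) x fun k => by
    rw [starTop_succ_cons, ← one_sub_q_pow_mul_qInt_inv k]
    ring
  refine mul_left_cancel₀ (left_ne_zero_of_mul_eq_one (one_sub_mul_inv x)) ?_
  linear_combination x * h - newtonSeries (starTop (i :: u)) (q * x) * one_sub_mul_diffFactor x

theorem newtonDiff_starTop_singleton_one (x : R) :
    x * newtonDiff (starTop [1]) x = diffFactor x := by
  have h := newtonDiff_of_mul_eq_one (b := starTop [1]) x fun k => by
    rw [starTop_singleton_one, one_sub_q_pow_mul_qInt_inv]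
  refine mul_left_cancel₀ (left_ne_zero_of_mul_eq_one (one_sub_mul_inv x)) ?_
  linear_combination x * h - one_sub_mul_diffFactor x

theorem phiWord_ne_nil {u : List ℕ+} (hu : u ≠ []) : phiWord u ≠ [] := by
  obtain ⟨k, v, h, -⟩ := exists_phiWord_one_cons hu
  simp [h]

/-- Each unit of the first letter is a `z_1` prepended to the dual word, and so contributes one
`diffFactor`; the last unit passes to `u` and moves the argument to `qx`. -/
theorem newtonDiff_starTop_phiWord (k : ℕ+) (u : List ℕ+) (x : R) :
    x * newtonDiff (starTop (phiWord (k :: u))) x =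
      diffFactor x ^ (k : ℕ) * kawashimaWord (q * x) u := by
  induction k using PNat.recOn with
  | one =>
    rw [PNat.one_coe, pow_one]
    rcases eq_or_ne u [] with rfl | hu
    · rw [phiWord_singleton_one, newtonDiff_starTop_singleton_one, kawashimaWord, mul_one]
    · obtain ⟨j, v, h, h'⟩ := exists_phiWord_one_cons hu
      rw [h', newtonDiff_starTop_succ_cons, kawashimaWord_of_ne_nil _ hu, h]
  | succ k ih =>
    rw [phiWord_succ_cons, newtonDiff_starTop_one_cons (phiWord_ne_nil (List.cons_ne_nil _ _)),
      mul_left_comm, ih, PNat.add_coe, PNat.one_coe]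
    ring

theorem kawashimaWord_q_mul_sub (k : ℕ+) (u : List ℕ+) (x : R) :
    kawashimaWord (q * x) (k :: u) - kawashimaWord x (k :: u) =
      diffFactor x ^ (k : ℕ) * kawashimaWord (q * x) u := by
  rw [kawashimaWord, kawashimaWord, newtonSeries_q_mul_sub, newtonDiff_starTop_phiWord]

theorem kawashima_q_mul_sub (k : ℕ+) (w : H1) (x : R) :
    kawashima (q * x) (z k * w) - kawashima x (z k * w) =
      diffFactor x ^ (k : ℕ) * kawashima (q * x) w := by
  induction w using induction_words with
  | word u => simp only [← word_cons, kawashima_word, kawashimaWord_q_mul_sub]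
  | zero => rw [mul_zero, map_zero, map_zero, sub_zero, mul_zero]
  | add a b ha hb =>
    simp only [mul_add, map_add, ← ha, ← hb]
    ring
  | smul c a ha =>
    simp only [mul_smul_comm, LinearMap.map_smulₛₗ, smul_eq_mul]
    rw [mul_left_comm, ← ha, mul_sub]

theorem kawashima_one_z_mul (k : ℕ+) (w : H1) : kawashima 1 (z k * w) = 0 := by
  induction w using induction_words with
  | word u => rw [← word_cons, kawashima_word, kawashimaWord, newtonSeries_one]
  | zero => rw [mul_zero, map_zero]
  | add a b ha hb => rw [mul_add, map_add, ha, hb, add_zero]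
  | smul c a ha => rw [mul_smul_comm, LinearMap.map_smulₛₗ, ha, smul_zero]

theorem sub_dvd_kawashima_sub (w : H1) (x y : R) : x - y ∣ kawashima x w - kawashima y w := by
  induction w using induction_words with
  | word u =>
    rw [kawashima_word, kawashima_word]
    cases u with
    | nil => simp [kawashimaWord]
    | cons k u => exact sub_dvd_newtonSeries_sub _ x y
  | zero => rw [map_zero, map_zero, sub_zero]; exact dvd_zero _
  | add a b ha hb =>
    rw [map_add, map_add, add_sub_add_comm]
    exact dvd_add ha hb
  | smul c a ha =>
    rw [LinearMap.map_smulₛₗ, LinearMap.map_smulₛₗ, ← smul_sub]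
    exact ha.mul_left _

/-- The points `q^n x` and `q^n` become congruent modulo `q^n`; the divisibility hypothesis plays
the role of continuity at `0`. -/
theorem eq_one_of_q_mul_eq {G : R → R} (hG : ∀ x y, x - y ∣ G x - G y)
    (h : ∀ x, G (q * x) = G x) (x : R) : G x = G 1 := by
  have hn : ∀ (n : ℕ) (x : R), G (q ^ n * x) = G x := by
    intro n
    induction n with
    | zero => simp
    | succ n ih =>
      intro x
      rw [pow_succ', mul_assoc, h, ih]
  refine sub_eq_zero.1 (eq_zero_of_forall_q_pow_dvd fun n => ?_)
  have := hG (q ^ n * x) (q ^ n * 1)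
  rw [hn, hn, ← mul_sub] at this
  exact dvd_of_mul_right_dvd this

theorem kawashima_barStarWord (u v : List ℕ+) (x : R) :
    kawashima x (barStarWord u v) = kawashima x (word u) * kawashima x (word v) := by
  induction u, v using barStarWord.induct generalizing x with
  | case1 v => rw [barStarWord, kawashima_word x [], kawashimaWord, one_mul]
  | case2 i u => rw [barStarWord, kawashima_word x [], kawashimaWord, mul_one]
  | case3 i u j v ih₁ ih₂ ih₃ =>
    set W := barStarWord (i :: u) (j :: v) with hW
    have hG := eq_one_of_q_mul_eq
      (G := fun x => kawashima x W -
        kawashima x (word (i :: u)) * kawashima x (word (j :: v))) ?_ ?_ x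
    · have h₁ : kawashima 1 W = 0 := by
        rw [hW, barStarWord, map_sub, map_add, kawashima_one_z_mul, kawashima_one_z_mul,
          kawashima_one_z_mul, add_zero, sub_zero]
      have h₂ : kawashima 1 (word (i :: u)) = 0 := by rw [word_cons, kawashima_one_z_mul]
      simp only [h₁, h₂, zero_mul, sub_zero] at hG
      exact sub_eq_zero.1 hG
    · intro x y
      have h := dvd_sub (sub_dvd_kawashima_sub W x y)
        (dvd_add ((sub_dvd_kawashima_sub (word (i :: u)) x y).mul_right
          (kawashima x (word (j :: v))))
          ((sub_dvd_kawashima_sub (word (j :: v)) x y).mul_left (kawashima y (word (i :: u)))))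
      convert h using 1
      ring
    -- With `Δ` the difference between `qx` and `x`, `Δ(FG) = ΔF·G(qx) + F(qx)·ΔG - ΔF·ΔG`; the
    -- three terms match those of `*̄`.
    · intro x
      have hu := kawashima_q_mul_sub i (word u) x
      have hv := kawashima_q_mul_sub j (word v) x
      have h₁ := kawashima_q_mul_sub i (barStarWord u (j :: v)) x
      have h₂ := kawashima_q_mul_sub j (barStarWord (i :: u) v) x
      have h₃ := kawashima_q_mul_sub (i + j) (barStarWord u v) x
      rw [ih₁, word_cons] at h₁
      rw [ih₂, word_cons] at h₂
      rw [ih₃, PNat.add_coe, pow_add] at h₃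
      simp only [hW, barStarWord, map_add, map_sub, word_cons]
      linear_combination h₁ + h₂ - h₃ - kawashima (q * x) (z j * word v) * hu -
        kawashima x (z i * word u) * hv +
        diffFactor x ^ (j : ℕ) * kawashima (q * x) (word v) * hu

theorem kawashima_barStar (w₁ w₂ : H1) (x : R) :
    kawashima x (barStar w₁ w₂) = kawashima x w₁ * kawashima x w₂ := by
  induction w₁ using induction_words with
  | word u =>
    induction w₂ using induction_words with
    | word v => rw [barStar_word, kawashima_barStarWord]
    | zero => simp only [map_zero, mul_zero]
    | add a b ha hb => rw [map_add, map_add, map_add, ha, hb, mul_add]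
    | smul c a ha =>
      rw [map_smul, LinearMap.map_smulₛₗ, LinearMap.map_smulₛₗ, ha, smul_eq_mul, smul_eq_mul,
        mul_left_comm]
  | zero => simp only [map_zero, LinearMap.zero_apply, zero_mul]
  | add a b ha hb => rw [map_add, LinearMap.add_apply, map_add, map_add, ha, hb, add_mul]
  | smul c a ha =>
    rw [map_smul, LinearMap.smul_apply, LinearMap.map_smulₛₗ, LinearMap.map_smulₛₗ, ha,
      smul_eq_mul, smul_eq_mul, mul_assoc]

/-! ### The derivative at `x = 1` -/

/-- The derivative of `kawashimaWord x u` at `x = 1`. -/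
def slopeWord : List ℕ+ → R
  | [] => 0
  | k :: u => -(q * qSum fun m => starTop (phiWord (k :: u)) m * (1 - q ^ (m + 1))⁻¹)

/-- The `𝒞`-linear extension of `slopeWord` to `𝔥¹`. -/
def slope : H1 →ₛₗ[hbarEval.toRingHom] R := liftWords slopeWord

theorem kawashima_one_add (w : H1) (y : R) :
    y ^ 2 ∣ kawashima (1 + y) w - kawashima 1 w - y * slope w := by
  induction w using induction_words with
  | word u =>
    rw [kawashima_word, kawashima_word, slope, liftWords_word]
    cases u with
    | nil => simp [kawashimaWord, slopeWord]
    | cons k u =>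
      rw [kawashimaWord, kawashimaWord, slopeWord, newtonSeries_one, sub_zero]
      exact newtonSeries_one_add _ y
  | zero => simp only [map_zero, sub_zero, mul_zero, dvd_zero]
  | add a b ha hb =>
    convert dvd_add ha hb using 1
    simp only [map_add]
    ring
  | smul c a ha =>
    convert ha.mul_left (hbarEval.toRingHom c) using 1
    simp only [LinearMap.map_smulₛₗ, smul_eq_mul]
    ring

theorem kawashima_one_of_mem_H1pos {w : H1} (hw : w ∈ H1pos) : kawashima 1 w = 0 := by
  induction hw using Submodule.span_induction with
  | mem x hx =>
    obtain ⟨u, hu, rfl⟩ := hx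
    rw [kawashima_word, kawashimaWord_of_ne_nil _ hu, newtonSeries_one]
  | zero => rw [map_zero]
  | add a b _ _ ha hb => rw [map_add, ha, hb, add_zero]
  | smul c a _ ha => rw [LinearMap.map_smulₛₗ, ha, smul_zero]

theorem slope_barStar {w₁ w₂ : H1} (hw₁ : w₁ ∈ H1pos) (hw₂ : w₂ ∈ H1pos) :
    slope (barStar w₁ w₂) = 0 := by
  have hdvd : ∀ {w : H1} (y : R), w ∈ H1pos → y ∣ kawashima (1 + y) w := fun {w} y hw => by
    have h := sub_dvd_kawashima_sub w (1 + y) 1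
    rwa [kawashima_one_of_mem_H1pos hw, sub_zero, add_sub_cancel_left] at h
  refine eq_zero_of_forall_q_pow_dvd fun n => ?_
  -- At `y = q^n` the product is divisible by `q^{2n}`, hence so is `q^n` times the slope;
  -- cancelling `q^n` leaves arbitrarily high divisibility.
  have h := kawashima_one_add (barStar w₁ w₂) (q ^ n)
  rw [kawashima_barStar, kawashima_barStar, kawashima_one_of_mem_H1pos hw₁, zero_mul, sub_zero,
    sq] at h
  have h' := (dvd_sub_right (mul_dvd_mul (hdvd (q ^ n) hw₁) (hdvd (q ^ n) hw₂))).1 h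
  exact (mul_dvd_mul_iff_left (pow_ne_zero n PowerSeries.X_ne_zero)).1 h'

theorem q_pow_dvd_A_circ_d_phi_add (w : H1) (n : ℕ) :
    q ^ n ∣ A (circ 1 (d (phi w))) n + (1 - q) * slope w := by
  induction w using induction_words with
  | word u =>
    rw [slope, liftWords_word, phi_word, d_word]
    cases u with
    | nil =>
      have h : circ 1 (dWord (phiWord [])) = 0 := circ_word_nil 1
      rw [h, A_eq_liftWords, map_zero, slopeWord, mul_zero, add_zero]
      exact dvd_zero _
    | cons k u =>
      have h : ∑ m ∈ Finset.range n, top (m + 1) (circ 1 (dWord (phiWord (k :: u)))) =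
          (1 - q) * q * ∑ m ∈ Finset.range n,
            q ^ m * (starTop (phiWord (k :: u)) m * (1 - q ^ (m + 1))⁻¹) := by
        rw [Finset.mul_sum]
        refine Finset.sum_congr rfl fun m _ => ?_
        -- The factor `q^{m+1}/[m+1]` produced by `z₁ ∘` equals `(1-q)q^{m+1}/(1-q^{m+1})`, the
        -- weight in the slope up to `-(1-q)`.
        rw [top_circ, PNat.one_coe, pow_one, ← starTop]
        refine mul_left_cancel₀ (one_sub_q_pow_ne_zero m) ?_
        linear_combination q ^ (m + 1) * starTop (phiWord (k :: u)) m *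
          (one_sub_q_pow_mul_qInt_inv m - (1 - q) * one_sub_q_pow_mul_inv m)
      rw [slopeWord, A_eq_sum_top, A_circ_zero, zero_add, h]
      convert (q_pow_dvd_qSum_sub (fun m => starTop (phiWord (k :: u)) m * (1 - q ^ (m + 1))⁻¹)
        n).mul_left (-((1 - q) * q)) using 1
      ring
  | zero => simp only [map_zero, A_eq_liftWords, mul_zero, add_zero, dvd_zero]
  | add a b ha hb =>
    convert dvd_add ha hb using 1
    simp only [map_add, A_eq_liftWords]
    ring
  | smul c a ha =>
    convert ha.mul_left (hbarEval.toRingHom c) using 1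
    simp only [map_smul, LinearMap.map_smulₛₗ, smul_eq_mul, A_eq_liftWords]
    ring

/-! ### The `q`-adic topology -/

theorem hasBasis_nhds_zero :
    (𝓝 (0 : R)).HasBasis (fun _ : ℕ => True) fun n => {a : R | q ^ n ∣ a} := by
  convert Ideal.hasBasis_nhds_zero_adic (Ideal.span {q}) using 2 with n
  ext a
  rw [Ideal.span_singleton_pow, SetLike.mem_coe, Ideal.mem_span_singleton, Set.mem_ofPred_eq]

theorem tendsto_zero_of_q_pow_dvd {f : ℕ → R} (h : ∀ n, q ^ n ∣ f n) :
    Tendsto f atTop (𝓝 0) := by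
  rw [hasBasis_nhds_zero.tendsto_right_iff]
  intro n _
  filter_upwards [eventually_ge_atTop n] with m hm
  exact (pow_dvd_pow q hm).trans (h m)

/-- Needed because `zetaQ` is a `limUnder`, whose value is pinned down only when limits are unique.
-/
theorem t2Space_qAdic : T2Space R := by
  have := (Ideal.span {q}).adic_basis.toRing_subgroups_basis.nonarchimedean
  have : IsTopologicalAddGroup R := this.toIsTopologicalRing.to_topologicalAddGroup
  refine IsTopologicalAddGroup.t2Space_of_zero_sep fun a ha => ?_
  have : ∃ n : ℕ, ¬ q ^ n ∣ a := not_forall.1 fun h => ha (eq_zero_of_forall_q_pow_dvd h)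
  obtain ⟨n, hn⟩ := this
  exact ⟨_, hasBasis_nhds_zero.mem_of_mem (i := n) trivial, hn⟩

end QMZV

end

/-- For all `w₁, w₂ ∈ 𝔥¹_{>0}`, the element `z₁ ∘ d(φ(w₁ *̄ w₂))` lies in `𝔥⁰`, the series defining
its `ζ_q` converges, and `ζ_q(z₁ ∘ d(φ(w₁ *̄ w₂))) = 0`. -/
theorem mainTheorem2 (w₁ w₂ : QMZV.H1) (hw₁ : w₁ ∈ QMZV.H1pos) (hw₂ : w₂ ∈ QMZV.H1pos) :
    ∃ h : QMZV.circ 1 (QMZV.d (QMZV.phi (QMZV.barStar w₁ w₂))) ∈ QMZV.H0,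
      Tendsto (QMZV.A (QMZV.circ 1 (QMZV.d (QMZV.phi (QMZV.barStar w₁ w₂))))) atTop
          (𝓝 (QMZV.zetaQ ⟨_, h⟩)) ∧
        QMZV.zetaQ ⟨_, h⟩ = 0 := by
  have ht : Tendsto (QMZV.A (QMZV.circ 1 (QMZV.d (QMZV.phi (QMZV.barStar w₁ w₂))))) atTop
      (𝓝 0) := QMZV.tendsto_zero_of_q_pow_dvd fun n => by
    have h := QMZV.q_pow_dvd_A_circ_d_phi_add (QMZV.barStar w₁ w₂) n
    rwa [QMZV.slope_barStar hw₁ hw₂, mul_zero, add_zero] at h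
  refine ⟨QMZV.circ_mem_H0 1 _, ?_⟩
  have h0 : QMZV.zetaQ ⟨_, QMZV.circ_mem_H0 1 (QMZV.d (QMZV.phi (QMZV.barStar w₁ w₂)))⟩ = 0 :=
    haveI := QMZV.t2Space_qAdic
    ht.limUnder_eq
  exact ⟨by rwa [h0], h0⟩
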